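/- Let $r\ge 1$, let $\mathscr P=\{\mathbf m\in\mathbb Z_{\ge0}^r: m_1\ge\dots\ge m_r\}$, write $\mathbf k\subset\mathbf m$ if $k_j\le m_j$ for all $j$, $|\mathbf k|=k_1+\dots+k_r$, $\delta=(r-1,r-2,\dots,0)$, $\delta!=\prod_{j=1}^{r}(r-j)!$, and $(a)_k=a(a+1)\cdots(a+k-1)$. For $\mathbf m\in\mathscr P$ let $s_{\mathbf m}(\lambda_1,\dots,\lambda_r)=\det(\lambda_j^{m_k+r-k})/\det(\lambda_j^{r-k})$ be the Schur polynomial and let $\Phi_{\mathbf m}=s_{\mathbf m}/s_{\mathbf m}(1,\dots,1)$ (the spherical polynomial for multiplicity $d=2$). Let $\binom{\mathbf m}{\mathbf k}$ be the coefficients of the expansion $\Phi_{\mathbf m}(1+\lambda_1,\dots,1+\lambda_r)=\sum_{\mathbf k}\binom{\mathbf m}{\mathbf k}\Phi_{\mathbf k}(\lambda_1,\dots,\lambda_r)$. Put $d_{\mathbf k}=\prod_{1\le p<q\le r}\left(\frac{k_p-k_q+q-p}{q-p}\right)^2$ and $(a)_{\mathbf k}=\prod_{j=1}^r(a-j+1)_{k_j}$.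 The multivariate Meixner, Charlier and Krawtchouk polynomials (for $d=2$) are $$M_{\mathbf m}(\mathbf x;\alpha,c)=\sum_{\mathbf k\subset\mathbf m}\frac1{d_{\mathbf k}}\frac{(r)_{\mathbf k}}{(\alpha)_{\mathbf k}}\binom{\mathbf m}{\mathbf k}\binom{\mathbf x}{\mathbf k}\Bigl(1-\frac1c\Bigr)^{|\mathbf k|},\qquad C_{\mathbf m}(\mathbf x;a)=\sum_{\mathbf k\subset\mathbf m}\frac{(r)_{\mathbf k}}{d_{\mathbf k}}\binom{\mathbf m}{\mathbf k}\binom{\mathbf x}{\mathbf k}\Bigl(-\frac1a\Bigr)^{|\mathbf k|},$$ $$K_{\mathbf m}(\mathbf x;p,N)=\sum_{\mathbf k\subset\mathbf m}\frac1{d_{\mathbf k}}\frac{(r)_{\mathbf k}}{(-N)_{\mathbf k}}\binom{\mathbf m}{\mathbf k}\binom{\mathbf x}{\mathbf k}\Bigl(\frac1p\Bigr)^{|\mathbf k|}\qquad(\mathbf m\subset(N,\dots,N)),$$ and the one variable polynomials are $M_m(x;\alpha,c)=\sum_{k=0}^m\frac{k!}{(\alpha)_k}\binom mk\binom xk(1-\frac1c)^k$,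 $C_m(x;a)=\sum_{k=0}^m k!\binom mk\binom xk(-\frac1a)^k$, $K_m(x;p,N)=\sum_{k=0}^m\frac{k!}{(-N)_k}\binom mk\binom xk(\frac1p)^k$. Then the following hold. (1) For all $\mathbf m,\mathbf x\in\mathscr P$, all $\alpha\in\mathbb C$ that are not an integer $\le r-1$, and all $c\in\mathbb C\setminus\{0\}$, with $c\ne1$ if $r\ge2$, $$M_{\mathbf m}(\mathbf x;\alpha,c)=\frac1{\delta!}\,\frac{(1-\frac1c)^{-r(r-1)/2}}{s_{\mathbf m}(1,\dots,1)\,s_{\mathbf x}(1,\dots,1)}\prod_{j=1}^r(\alpha-r+1)_{j-1}\;\det\bigl(M_{m_\mu+r-\mu}(x_\nu+r-\nu;\alpha-r+1,c)\bigr)_{1\le\mu,\nu\le r}.$$ (2) For all $\mathbf m,\mathbf x\in\mathscr P$ and $a\in\mathbb C\setminus\{0\}$, $$C_{\mathbf m}(\mathbf x;a)=\frac1{\delta!}\,\frac{(-a)^{r(r-1)/2}}{s_{\mathbf m}(1,\dots,1)\,s_{\mathbf x}(1,\dots,1)}\det\bigl(C_{m_\mu+r-\mu}(x_\nu+r-\nu;a)\bigr)_{1\le\mu,\nu\le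 r}.$$ (3) For all $N\in\mathbb Z_{\ge0}$, $p\in\mathbb C\setminus\{0\}$ and $\mathbf m,\mathbf x\in\mathscr P$ with $\mathbf m,\mathbf x\subset(N,\dots,N)$, $$K_{\mathbf m}(\mathbf x;p,N)=\frac1{\delta!}\,\frac{p^{r(r-1)/2}}{s_{\mathbf m}(1,\dots,1)\,s_{\mathbf x}(1,\dots,1)}\prod_{j=1}^r(-N-r+1)_{j-1}\;\det\bigl(K_{m_\mu+r-\mu}(x_\nu+r-\nu;p,N+r-1)\bigr)_{1\le\mu,\nu\le r}.$$ -/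

import Mathlib

noncomputable section

open MvPolynomial Finset

namespace MultiDOP

/-- The set `𝒫` of partitions of length (at most) `r`: weakly decreasing `r`-tuples of natural
numbers.  The induced order is containment of partitions, `k ≤ m ↔ ∀ j, k j ≤ m j`. -/
abbrev Part (r : ℕ) : Type := {m : Fin r → ℕ // Antitone m}

/-- `δ = (r - 1, r - 2, …, 1, 0)`. -/
def delta (r : ℕ) : Fin r → ℕ := fun j => r - 1 - (j : ℕ)

/-- `m! = m₁! ⋯ m_r!`. -/
def multiFactorial {r : ℕ} (m : Fin r → ℕ) : ℕ := ∏ j, (m j).factorial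

/-- `|m| = m₁ + ⋯ + m_r`. -/
def weight {r : ℕ} (m : Part r) : ℕ := ∑ j, m.1 j

/-- The alternant `det (λ_j ^ (a_k))`, a polynomial in `λ₁, …, λ_r`. -/
def alternant {r : ℕ} (a : Fin r → ℕ) : MvPolynomial (Fin r) ℂ :=
  Matrix.det (Matrix.of fun j k => (X j : MvPolynomial (Fin r) ℂ) ^ a k)

theorem delta_eq_rev {r : ℕ} (j : Fin r) : delta r j = (Fin.rev j : ℕ) := by
  simp only [delta, Fin.val_rev]; omega

theorem alternant_delta {r : ℕ} : ∃ e : ℤˣ, alternant (delta r) =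
    ((e : ℤ) : MvPolynomial (Fin r) ℂ) *
      ∏ i : Fin r, ∏ j ∈ Ioi i, ((X j : MvPolynomial (Fin r) ℂ) - X i) := by
  refine ⟨Equiv.Perm.sign (Fin.revPerm : Equiv.Perm (Fin r)), ?_⟩
  rw [← Matrix.det_vandermonde, ← Matrix.det_permute']
  unfold alternant
  congr 1
  ext1 j k
  simp [Matrix.vandermonde_apply, delta_eq_rev]

theorem irreducible_X_sub_X {r : ℕ} {i j : Fin r} (h : i ≠ j) :
    Irreducible ((X j : MvPolynomial (Fin r) ℂ) - X i) := by
  have hc : coeff (Finsupp.single j 1) ((X j : MvPolynomial (Fin r) ℂ) - X i) = 1 := by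
    simp [coeff_X, Finsupp.single_left_inj, h]
  apply irreducible_of_totalDegree_eq_one
  · apply le_antisymm
    · exact (totalDegree_sub _ _).trans (by simp)
    · have hm : Finsupp.single j 1 ∈ ((X j : MvPolynomial (Fin r) ℂ) - X i).support := by
        rw [mem_support_iff, hc]; exact one_ne_zero
      simpa using le_totalDegree hm
  · intro x hx
    have := hx (Finsupp.single j 1)
    rw [hc] at this
    exact isUnit_of_dvd_one this

/-- Every alternant is divisible by the Vandermonde alternant `det (λ_j ^ (r - k))`. -/
theorem alternant_delta_dvd {r : ℕ} (a : Fin r → ℕ) : alternant (delta r) ∣ alternant a := by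
  obtain ⟨e, he⟩ := alternant_delta (r := r)
  rw [he]
  have hu : IsUnit (((e : ℤ) : MvPolynomial (Fin r) ℂ)) :=
    (e.isUnit).map (Int.castRingHom (MvPolynomial (Fin r) ℂ))
  rw [hu.mul_left_dvd, Finset.prod_sigma']
  apply Finset.prod_dvd_of_isRelPrime
  · rintro ⟨i, j⟩ hij ⟨k, l⟩ hkl hne
    simp only [coe_sigma, Set.mem_sigma_iff, coe_univ, Set.mem_univ, true_and, mem_coe,
      mem_Ioi] at hij hkl
    change IsRelPrime ((X j : MvPolynomial (Fin r) ℂ) - X i) (X l - X k)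
    rw [(irreducible_X_sub_X hij.ne).isRelPrime_iff_not_dvd]
    rintro ⟨q, hq⟩
    have := congrArg (eval (fun t : Fin r => if t = j then ((i : ℕ) : ℂ) else ((t : ℕ) : ℂ))) hq
    simp only [map_sub, eval_X, map_mul, if_true, if_neg hij.ne, sub_self, zero_mul] at this
    by_cases h1 : l = j
    · have hk : k ≠ j := by rintro rfl; exact hkl.ne h1.symm
      rw [if_pos h1, if_neg hk, sub_eq_zero, Nat.cast_inj] at this
      have : i = k := Fin.ext this
      subst this h1; exact hne rfl
    · rw [if_neg h1] at this
      by_cases h2 : k = j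
      · rw [if_pos h2, sub_eq_zero, Nat.cast_inj] at this
        have : l = i := Fin.ext this
        subst this h2; exact absurd hij hkl.asymm
      · rw [if_neg h2, sub_eq_zero, Nat.cast_inj] at this
        exact hkl.ne' (Fin.ext this)
  · rintro ⟨i, j⟩ hij
    simp only [mem_sigma, mem_univ, true_and, mem_Ioi] at hij
    change ((X j : MvPolynomial (Fin r) ℂ) - X i) ∣ _
    rw [← Ideal.mem_span_singleton, ← Ideal.Quotient.eq_zero_iff_mem]
    set f := Ideal.Quotient.mk (Ideal.span {(X j : MvPolynomial (Fin r) ℂ) - X i})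
    have hX : f (X j) = f (X i) := by
      rw [← sub_eq_zero, ← map_sub, Ideal.Quotient.eq_zero_iff_mem]
      exact Ideal.mem_span_singleton_self _
    unfold alternant
    rw [RingHom.map_det]
    apply Matrix.det_zero_of_row_eq hij.ne
    ext k
    simp [hX]

theorem alternant_delta_ne_zero (r : ℕ) : alternant (delta r) ≠ 0 := by
  obtain ⟨e, he⟩ := alternant_delta (r := r)
  rw [he]
  have hu : IsUnit (((e : ℤ) : MvPolynomial (Fin r) ℂ)) :=
    (e.isUnit).map (Int.castRingHom (MvPolynomial (Fin r) ℂ))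
  refine mul_ne_zero hu.ne_zero (prod_ne_zero_iff.2 fun i _ => prod_ne_zero_iff.2 fun j hj => ?_)
  exact (irreducible_X_sub_X (mem_Ioi.1 hj).ne).ne_zero

/-- The Schur polynomial `s_m = det (λ_j ^ (m_k + r - k)) / det (λ_j ^ (r - k))`. -/
def schur {r : ℕ} (m : Part r) : MvPolynomial (Fin r) ℂ :=
  Classical.choose (alternant_delta_dvd (m.1 + delta r))

/-- The defining property of the quotient; as `alternant (delta r) ≠ 0`, it determines `schur m`. -/
theorem alternant_delta_mul_schur {r : ℕ} (m : Part r) :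
    alternant (delta r) * schur m = alternant (m.1 + delta r) :=
  (Classical.choose_spec (alternant_delta_dvd (m.1 + delta r))).symm

/-- `s_m (1, …, 1)`. -/
def schurOne {r : ℕ} (m : Part r) : ℂ := eval (fun _ => 1) (schur m)

theorem specialize_alternant {r : ℕ} (a : Fin r → ℕ) :
    aeval (fun j : Fin r => (Polynomial.X : Polynomial ℂ) ^ (j : ℕ)) (alternant a) =
      ∏ i : Fin r, ∏ j ∈ Ioi i, ((Polynomial.X : Polynomial ℂ) ^ a j - Polynomial.X ^ a i) := by
  rw [← Matrix.det_vandermonde, ← Matrix.det_transpose, alternant, AlgHom.map_det]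
  congr 1
  ext1 j k
  simp [Matrix.vandermonde_apply, ← pow_mul, mul_comm]

/-- `s_m(1, …, 1) = ∏_{p < q} (m_p - m_q + q - p) / (q - p)`. -/
theorem schurOne_eq {r : ℕ} (m : Part r) :
    schurOne m = ∏ p : Fin r, ∏ q ∈ Ioi p,
      (((m.1 p : ℂ) - m.1 q + (q : ℕ) - (p : ℕ)) / ((q : ℕ) - (p : ℕ))) := by
  classical
  let g : ℕ → ℕ → Polynomial ℂ := fun a b =>
    ∑ i ∈ range a, Polynomial.X ^ i - ∑ i ∈ range b, Polynomial.X ^ i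
  have hg : ∀ a b, (Polynomial.X : Polynomial ℂ) ^ a - Polynomial.X ^ b =
      (Polynomial.X - 1) * g a b := by
    intro a b
    simp only [g, mul_sub, mul_geom_sum]; ring
  have hg1 : ∀ a b, (g a b).eval 1 = (a : ℂ) - b := by
    intro a b; simp [g, Polynomial.eval_finsetSum]
  have h := congrArg
    (aeval (fun j : Fin r => (Polynomial.X : Polynomial ℂ) ^ (j : ℕ))) (alternant_delta_mul_schur m)
  rw [map_mul, specialize_alternant, specialize_alternant] at h
  simp only [hg, prod_mul_distrib] at h
  rw [mul_assoc] at h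
  have hne : (∏ i : Fin r, ∏ _j ∈ Ioi i, ((Polynomial.X : Polynomial ℂ) - 1)) ≠ 0 :=
    prod_ne_zero_iff.2 fun i _ => prod_ne_zero_iff.2 fun j _ => by
      simpa using Polynomial.X_sub_C_ne_zero (1 : ℂ)
  have h := congrArg (Polynomial.eval 1) (mul_left_cancel₀ hne h)
  have hs : Polynomial.eval 1 (aeval (fun j : Fin r => (Polynomial.X : Polynomial ℂ) ^ (j : ℕ))
      (schur m)) = schurOne m := by
    rw [schurOne, ← Polynomial.coe_aeval_eq_eval, ← AlgHom.comp_apply, comp_aeval]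
    simp [aeval_eq_eval]
  simp only [Polynomial.eval_mul, Polynomial.eval_prod, hg1, hs] at h
  simp only [prod_div_distrib]
  have hd : ∀ p q : Fin r, p < q → ((delta r q : ℂ) - delta r p) = -((q : ℕ) - (p : ℕ)) := by
    intro p q hpq
    have e : ∀ t : Fin r, (delta r t : ℂ) = (r : ℂ) - 1 - (t : ℕ) := by
      intro t
      have : delta r t + 1 + (t : ℕ) = r := by simp only [delta]; omega
      have h' : (delta r t : ℂ) + 1 + (t : ℕ) = r := by exact_mod_cast this
      linear_combination h'
    rw [e, e]; ring
  have hq : (∏ p : Fin r, ∏ q ∈ Ioi p, (((q : ℕ) : ℂ) - (p : ℕ))) ≠ 0 :=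
    prod_ne_zero_iff.2 fun i _ => prod_ne_zero_iff.2 fun j hj => by
      rw [sub_ne_zero, Ne, Nat.cast_inj, ← Fin.ext_iff]; exact (mem_Ioi.1 hj).ne'
  have h1 : (∏ p : Fin r, ∏ q ∈ Ioi p, ((delta r q : ℂ) - delta r p)) =
      (∏ p : Fin r, ∏ _q ∈ Ioi p, (-1 : ℂ)) * ∏ p : Fin r, ∏ q ∈ Ioi p, (((q : ℕ) : ℂ) - (p : ℕ)) := by
    simp only [← prod_mul_distrib]
    refine prod_congr rfl fun p _ => prod_congr rfl fun q hq => ?_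
    rw [hd p q (mem_Ioi.1 hq)]; ring
  have h2 : (∏ p : Fin r, ∏ q ∈ Ioi p,
        (((m.1 + delta r) q : ℕ) - ((m.1 + delta r) p : ℕ) : ℂ)) =
      (∏ p : Fin r, ∏ _q ∈ Ioi p, (-1 : ℂ)) *
        ∏ p : Fin r, ∏ q ∈ Ioi p, ((m.1 p : ℂ) - m.1 q + (q : ℕ) - (p : ℕ)) := by
    simp only [← prod_mul_distrib]
    refine prod_congr rfl fun p _ => prod_congr rfl fun q hq => ?_
    have := hd p q (mem_Ioi.1 hq)
    simp only [Pi.add_apply]; push_cast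
    linear_combination this
  rw [h1, h2, mul_assoc] at h
  have hm1 : (∏ p : Fin r, ∏ _q ∈ Ioi p, (-1 : ℂ)) ≠ 0 :=
    prod_ne_zero_iff.2 fun i _ => prod_ne_zero_iff.2 fun j _ => by norm_num
  have h := mul_left_cancel₀ hm1 h
  rw [eq_div_iff hq, ← h, mul_comm]

theorem schurOne_ne_zero {r : ℕ} (m : Part r) : schurOne m ≠ 0 := by
  rw [schurOne_eq]
  refine prod_ne_zero_iff.2 fun p _ => prod_ne_zero_iff.2 fun q hq => ?_
  have hpq : (p : ℕ) < q := Fin.lt_def.1 (mem_Ioi.1 hq)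
  have hm : m.1 q ≤ m.1 p := m.2 (mem_Ioi.1 hq).le
  refine div_ne_zero ?_ ?_
  · have : ((m.1 p : ℂ) - m.1 q + (q : ℕ) - (p : ℕ)) =
        ((m.1 p - m.1 q + (q - p) : ℕ) : ℂ) := by
      push_cast [Nat.cast_sub hm, Nat.cast_sub hpq.le]; ring
    rw [this, Nat.cast_ne_zero]; omega
  · rw [sub_ne_zero, Ne, Nat.cast_inj]; exact hpq.ne'

/-- The spherical polynomial for multiplicity `d = 2`:
`Φ_m (λ₁, …, λ_r) = s_m (λ₁, …, λ_r) / s_m (1, …, 1)`. -/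
def spherical {r : ℕ} (m : Part r) : MvPolynomial (Fin r) ℂ := C (schurOne m)⁻¹ * schur m

/-- `f (λ₁, …, λ_r) ↦ f (1 + λ₁, …, 1 + λ_r)`. -/
def shiftOne {r : ℕ} : MvPolynomial (Fin r) ℂ →ₐ[ℂ] MvPolynomial (Fin r) ℂ :=
  aeval fun j => 1 + X j

theorem alternant_eq_sum {r : ℕ} (a : Fin r → ℕ) : alternant a =
    ∑ σ : Equiv.Perm (Fin r), monomial (Finsupp.equivFunOnFinite.symm (a ∘ σ.symm))
      ((Equiv.Perm.sign σ : ℤ) : ℂ) := by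
  rw [alternant, Matrix.det_apply']
  refine sum_congr rfl fun σ _ => ?_
  rw [monomial_eq, Finsupp.prod_fintype _ _ (by simp)]
  rw [← Equiv.prod_comp σ (fun i => (X i : MvPolynomial (Fin r) ℂ) ^ _)]
  simp

theorem strictAnti_add_delta {r : ℕ} (m : Part r) : StrictAnti (m.1 + delta r) := by
  intro i j hij
  have h1 := m.2 hij.le
  have h2 : (i : ℕ) < j := hij
  have h3 := j.2
  simp only [Pi.add_apply, delta]; omega

theorem coeff_alternant {r : ℕ} (k l : Part r) :
    coeff (Finsupp.equivFunOnFinite.symm (k.1 + delta r)) (alternant (l.1 + delta r)) =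
      if k = l then 1 else 0 := by
  classical
  rw [alternant_eq_sum, coeff_sum]
  simp only [coeff_monomial, Equiv.apply_eq_iff_eq]
  have key : ∀ σ : Equiv.Perm (Fin r),
      (l.1 + delta r) ∘ σ.symm = k.1 + delta r → σ = 1 ∧ k = l := by
    intro σ h
    have hσ : StrictMono σ.symm := by
      intro i j hij
      have h1 := strictAnti_add_delta k hij
      rw [← h] at h1
      exact (strictAnti_add_delta l).lt_iff_gt.1 h1
    have h1 : σ.symm = 1 := by
      have := Subsingleton.elim
        (StrictMono.orderIsoOfSurjective _ hσ σ.symm.surjective) (OrderIso.refl (Fin r))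
      ext i
      have h2 := congrArg (fun e => e i) this
      exact congrArg Fin.val h2
    have h2 : σ = 1 := by
      have : σ⁻¹ = 1 := h1
      exact inv_eq_one.1 this
    refine ⟨h2, Subtype.ext ?_⟩
    subst h2
    exact (add_right_cancel (h : l.1 + delta r = k.1 + delta r)).symm
  split_ifs with hkl
  · subst hkl
    rw [sum_eq_single 1]
    · rw [if_pos (by rfl)]; simp
    · intro σ _ hσ
      rw [if_neg fun h => hσ (key σ h).1]
    · simp
  · exact sum_eq_zero fun σ _ => if_neg fun h => hkl (key σ h).2

theorem alternant_delta_mul_spherical {r : ℕ} (m : Part r) :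
    alternant (delta r) * spherical m = (schurOne m)⁻¹ • alternant (m.1 + delta r) := by
  rw [spherical, ← alternant_delta_mul_schur, smul_eq_C_mul]; ring

theorem linearIndependent_spherical (r : ℕ) :
    LinearIndependent ℂ (spherical : Part r → MvPolynomial (Fin r) ℂ) := by
  rw [linearIndependent_iff]
  intro b hb
  ext k
  have h := congrArg (fun f => coeff (Finsupp.equivFunOnFinite.symm (k.1 + delta r))
    (alternant (delta r) * f)) hb
  simp only [Finsupp.linearCombination_apply, Finsupp.sum, mul_sum, coeff_sum, mul_smul_comm,
    alternant_delta_mul_spherical, coeff_smul, coeff_alternant, mul_zero, coeff_zero] at h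
  simp only [smul_eq_mul, mul_ite, mul_one, mul_zero, sum_ite_eq, Finsupp.mem_support_iff] at h
  by_contra hk
  replace hk : b k ≠ 0 := hk
  rw [if_pos hk] at h
  exact mul_ne_zero hk (inv_ne_zero (schurOne_ne_zero k)) h

theorem alternant_mem_span {r : ℕ} (a : Fin r → ℕ) : alternant a ∈
    Submodule.span ℂ (Set.range fun k : Part r => alternant (k.1 + delta r)) := by
  by_cases ha : Function.Injective a
  · let τ : Equiv.Perm (Fin r) := Fin.revPerm.trans (Tuple.sort a)
    have hanti : StrictAnti (a ∘ τ) := by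
      have h1 : StrictMono (a ∘ Tuple.sort a) :=
        (Tuple.monotone_sort a).strictMono_of_injective (ha.comp (Tuple.sort a).injective)
      intro i j hij
      exact h1 (Fin.rev_lt_rev.2 hij)
    have hge : ∀ d : ℕ, ∀ i j : Fin r, (j : ℕ) = i + d → (a ∘ τ) j + d ≤ (a ∘ τ) i := by
      intro d
      induction d with
      | zero => intro i j h; have : j = i := Fin.ext h; subst this; simp
      | succ d ih =>
        intro i j h
        have hj := j.2
        have h1 := ih i ⟨i + d, by omega⟩ rfl
        have h2 : (a ∘ τ) j < (a ∘ τ) ⟨i + d, by omega⟩ :=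
          hanti (Fin.lt_def.2 (by simp only; omega))
        omega
    have hge' : ∀ i j : Fin r, i ≤ j → (a ∘ τ) j + (j - i : ℕ) ≤ (a ∘ τ) i := fun i j h =>
      hge _ i j (by have : (i : ℕ) ≤ j := h; omega)
    have hdel : ∀ i : Fin r, delta r i ≤ (a ∘ τ) i := by
      intro i
      have hi := i.2
      have := hge' i ⟨r - 1, by omega⟩ (Fin.le_def.2 (by simp only; omega))
      simp only [delta] at *; omega
    let k : Part r := ⟨fun i => (a ∘ τ) i - delta r i, by
      intro i j hij
      have h1 := hge' i j hij
      have h2 := hdel j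
      have h3 := j.2
      have h4 : (i : ℕ) ≤ j := hij
      simp only [delta] at *; omega⟩
    have hk : k.1 + delta r = a ∘ τ := by
      ext i; exact Nat.sub_add_cancel (hdel i)
    have hperm : alternant (a ∘ τ) = ((Equiv.Perm.sign τ : ℤ) : ℂ) • alternant a := by
      have h := Matrix.det_permute' τ
        (Matrix.of fun j k => (X j : MvPolynomial (Fin r) ℂ) ^ a k)
      have e : alternant (a ∘ τ) = (((Equiv.Perm.sign τ : ℤ)) : MvPolynomial (Fin r) ℂ) *
          alternant a := by
        unfold alternant; rw [← h]; rfl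
      rw [e, smul_eq_C_mul]; simp
    have hs : ((Equiv.Perm.sign τ : ℤ) : ℂ) * ((Equiv.Perm.sign τ : ℤ) : ℂ) = 1 := by
      rcases Int.units_eq_one_or (Equiv.Perm.sign τ) with h | h <;> simp [h]
    have : alternant a = ((Equiv.Perm.sign τ : ℤ) : ℂ) • alternant (k.1 + delta r) := by
      rw [hk, hperm, smul_smul, hs, one_smul]
    rw [this]
    exact Submodule.smul_mem _ _ (Submodule.subset_span ⟨k, rfl⟩)
  · have : alternant a = 0 := by
      rw [Function.not_injective_iff] at ha
      obtain ⟨i, j, hij, hne⟩ := ha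
      exact Matrix.det_zero_of_column_eq hne fun k => by simp [hij]
    rw [this]; exact Submodule.zero_mem _

theorem shiftOne_alternant_mem_span {r : ℕ} (a : Fin r → ℕ) : shiftOne (alternant a) ∈
    Submodule.span ℂ (Set.range fun k : Part r => alternant (k.1 + delta r)) := by
  classical
  have h : shiftOne (alternant a) = ∑ f ∈ Fintype.piFinset fun k => range (a k + 1),
      (∏ k, ((a k).choose (f k) : ℂ)) • alternant f := by
    have h1 : shiftOne (alternant a) = Matrix.det (Matrix.of fun k j =>
        ∑ i ∈ range (a k + 1), (((a k).choose i : ℂ) • (X j : MvPolynomial (Fin r) ℂ) ^ i)) := by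
      rw [← Matrix.det_transpose, alternant, AlgHom.map_det]
      congr 1
      ext1 j k
      simp [shiftOne, add_comm (1 : MvPolynomial (Fin r) ℂ), add_pow, smul_eq_C_mul, mul_comm]
    have h2 := (Matrix.detRowAlternating (n := Fin r) (R := MvPolynomial (Fin r) ℂ)
      ).toMultilinearMap.map_sum_finset (fun k i => fun j : Fin r =>
        ((a k).choose i : ℂ) • (X j : MvPolynomial (Fin r) ℂ) ^ i) (fun k => range (a k + 1))
    rw [h1]
    have h3 : (Matrix.of fun k j => ∑ i ∈ range (a k + 1),
        (((a k).choose i : ℂ) • (X j : MvPolynomial (Fin r) ℂ) ^ i)) = fun k : Fin r =>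
          ∑ i ∈ range (a k + 1), fun j : Fin r =>
            ((a k).choose i : ℂ) • (X j : MvPolynomial (Fin r) ℂ) ^ i := by
      ext1 k j; simp
    rw [h3]
    refine h2.trans (sum_congr rfl fun f _ => ?_)
    rw [smul_eq_C_mul, map_prod, alternant, ← Matrix.det_mul_row]
    change Matrix.det _ = _
    rw [← Matrix.det_transpose]
    congr 1
    ext1 j k
    simp [smul_eq_C_mul, Matrix.transpose_apply]
  rw [h]
  exact Submodule.sum_mem _ fun f _ => Submodule.smul_mem _ _ (alternant_mem_span f)

theorem shiftOne_alternant_delta (r : ℕ) :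
    shiftOne (alternant (delta r)) = alternant (delta r) := by
  obtain ⟨e, he⟩ := alternant_delta (r := r)
  rw [he]
  simp [shiftOne]

/-- `Φ_m (1 + λ)` has exactly one expansion `∑_k b_k Φ_k (λ)` in spherical polynomials. -/
theorem existsUnique_expansion {r : ℕ} (m : Part r) : ∃! b : Part r →₀ ℂ,
    shiftOne (spherical m) = b.sum fun k t => t • spherical k := by
  have hmem : shiftOne (spherical m) ∈ Submodule.span ℂ (Set.range (spherical (r := r))) := by
    have h1 : alternant (delta r) * shiftOne (spherical m) =
        (schurOne m)⁻¹ • shiftOne (alternant (m.1 + delta r)) := by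
      rw [← map_smul, ← alternant_delta_mul_spherical, map_mul, shiftOne_alternant_delta]
    have h2 := Submodule.smul_mem _ (schurOne m)⁻¹ (shiftOne_alternant_mem_span (m.1 + delta r))
    rw [← h1] at h2
    let A := LinearMap.mulLeft ℂ (alternant (delta r))
    have h3 : Submodule.span ℂ (Set.range fun k : Part r => alternant (k.1 + delta r)) ≤
        (Submodule.span ℂ (Set.range (spherical (r := r)))).map A := by
      rw [Submodule.span_le]
      rintro _ ⟨k, rfl⟩
      refine ⟨schurOne k • spherical k,
        Submodule.smul_mem _ _ (Submodule.subset_span ⟨k, rfl⟩), ?_⟩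
      change alternant (delta r) * (schurOne k • spherical k) = _
      rw [mul_smul_comm, alternant_delta_mul_spherical, smul_smul,
        mul_inv_cancel₀ (schurOne_ne_zero k), one_smul]
    obtain ⟨f, hf, hfe⟩ := h3 h2
    have : f = shiftOne (spherical m) := mul_left_cancel₀ (alternant_delta_ne_zero r) hfe
    exact this ▸ hf
  obtain ⟨b, hb⟩ := Finsupp.mem_span_range_iff_exists_finsupp.1 hmem
  refine ⟨b, hb.symm, fun b' hb' => ?_⟩
  apply linearIndependent_spherical r
  rw [Finsupp.linearCombination_apply, Finsupp.linearCombination_apply, ← hb', hb]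

/-- The generalized binomial coefficients `binom(m, k)`, defined by
`Φ_m (1 + λ₁, …, 1 + λ_r) = ∑_k binom(m, k) Φ_k (λ₁, …, λ_r)`. -/
def gbinom {r : ℕ} (m k : Part r) : ℂ := (existsUnique_expansion m).exists.choose k

theorem gbinom_spec {r : ℕ} (m : Part r) : ∃ h : (Function.support (gbinom m)).Finite,
    shiftOne (spherical m) = ∑ k ∈ h.toFinset, gbinom m k • spherical k := by
  have hs := (existsUnique_expansion m).exists.choose_spec
  have hf : (Function.support (gbinom m)).Finite :=
    Finsupp.hasFiniteSupport (existsUnique_expansion m).exists.choose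
  refine ⟨hf, hs.trans (sum_congr ?_ fun k _ => rfl)⟩
  ext k
  simp [gbinom]

/-- The dimension `d_m` for multiplicity `d = 2`:
`d_m = ∏_{p < q} ((m_p - m_q + q - p) / (q - p)) ^ 2`. -/
def dimPart {r : ℕ} (m : Part r) : ℂ :=
  ∏ p : Fin r, ∏ q ∈ Ioi p,
    (((m.1 p : ℂ) - m.1 q + (q : ℕ) - (p : ℕ)) / ((q : ℕ) - (p : ℕ))) ^ 2

theorem dimPart_eq {r : ℕ} (m : Part r) : dimPart m = schurOne m ^ 2 := by
  simp only [dimPart, schurOne_eq, prod_pow]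

/-- The shifted factorial `(a)_k = a (a + 1) ⋯ (a + k - 1)`. -/
def poch (a : ℂ) (k : ℕ) : ℂ := (ascPochhammer ℂ k).eval a

/-- The generalized shifted factorial for multiplicity `d = 2`:
`(a)_k = ∏_j (a - (j - 1))_{k_j}`, with `j = 1, …, r`. -/
def genPoch {r : ℕ} (a : ℂ) (k : Part r) : ℂ := ∏ j : Fin r, poch (a - (j : ℕ)) (k.1 j)

/-- The finite set of the partitions `k ⊂ m`. -/
def subparts {r : ℕ} (m : Part r) : Finset (Part r) :=
  (Set.Finite.preimage Subtype.val_injective.injOn (Set.finite_Iic m.1)).toFinset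

theorem mem_subparts {r : ℕ} {m k : Part r} : k ∈ subparts m ↔ ∀ j, k.1 j ≤ m.1 j := by
  simp only [subparts, Set.Finite.mem_toFinset, Set.mem_preimage, Set.mem_Iic, Pi.le_def]

/-- The multivariate Meixner polynomial `M_m (x; α, c)` for `d = 2` (so that `n / r = r`). -/
def meixner {r : ℕ} (m x : Part r) (α c : ℂ) : ℂ :=
  ∑ k ∈ subparts m, 1 / dimPart k * (genPoch r k / genPoch α k) * gbinom m k * gbinom x k *
    (1 - 1 / c) ^ weight k

/-- The multivariate Charlier polynomial `C_m (x; a)` for `d = 2`. -/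
def charlier {r : ℕ} (m x : Part r) (a : ℂ) : ℂ :=
  ∑ k ∈ subparts m, 1 / dimPart k * genPoch r k * gbinom m k * gbinom x k *
    (-1 / a) ^ weight k

/-- The multivariate Krawtchouk polynomial `K_m (x; p, N)` for `d = 2`. -/
def krawtchouk {r : ℕ} (m x : Part r) (p : ℂ) (N : ℕ) : ℂ :=
  ∑ k ∈ subparts m, 1 / dimPart k * (genPoch r k / genPoch (-(N : ℂ)) k) * gbinom m k *
    gbinom x k * (1 / p) ^ weight k

/-- The one variable Meixner polynomial `M_m (x; α, c)`. -/
def meixner₁ (m x : ℕ) (α c : ℂ) : ℂ :=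
  ∑ k ∈ range (m + 1), (k.factorial : ℂ) / poch α k * (m.choose k : ℂ) * (x.choose k : ℂ) *
    (1 - 1 / c) ^ k

/-- The one variable Charlier polynomial `C_m (x; a)`. -/
def charlier₁ (m x : ℕ) (a : ℂ) : ℂ :=
  ∑ k ∈ range (m + 1), (k.factorial : ℂ) * (m.choose k : ℂ) * (x.choose k : ℂ) * (-1 / a) ^ k

/-- The one variable Krawtchouk polynomial `K_m (x; p, N)`. -/
def krawtchouk₁ (m x : ℕ) (p : ℂ) (N : ℕ) : ℂ :=
  ∑ k ∈ range (m + 1), (k.factorial : ℂ) / poch (-(N : ℂ)) k * (m.choose k : ℂ) *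
    (x.choose k : ℂ) * (1 / p) ^ k

end MultiDOP

end

namespace MultiDOP

open MvPolynomial Finset

/-! The three formulas are one Cauchy–Binet identity with different weights. The Vandermonde
alternant is invariant under λ ↦ 1 + λ, so multiplying the expansion that defines `gbinom` by it
gives an expansion of the shifted alternant of m + δ in the alternants of k + δ. Reading off a
coefficient yields binom(m, k) = s_k(1)/s_m(1) · det binom(m_i + δ_i, k_j + δ_j) (`gbinom_eq_det`).

Now apply to the same expansion the functional that sends λ_j^l to w(l) binom(x_j + δ_j, l),
independently in each variable. On the left it gives the determinant of the one variable sums ∑_l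
w(l) binom(m_i + δ_i, l) binom(x_j + δ_j, l). On the right each alternant becomes ∏ w(k_j + δ_j)
times a multiple of binom(x, k), and d_k = s_k(1)^2 accounts for the Schur values. This is
`sum_gbinom_mul_gbinom`.

It remains to choose w: l! z^l for Charlier, and l! z^l / (α - r + 1)_l for Meixner and, with α =
-N, for Krawtchouk. Over k + δ the product of w splits into a constant depending on δ alone and the
multivariate weight at k; these constants are the prefactors. -/

/-! ### Functionals acting separately in each variable. -/

/-- The linear functional on polynomials sending the monomial `∏ j, X j ^ e j` to
`∏ j, g j (e j)`. -/
noncomputable def diagFunctional {r : ℕ} (g : Fin r → ℕ → ℂ) : MvPolynomial (Fin r) ℂ →ₗ[ℂ] ℂ :=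
  (basisMonomials (Fin r) ℂ).constr ℂ fun e => ∏ j, g j (e j)

theorem diagFunctional_monomial {r : ℕ} (g : Fin r → ℕ → ℂ) (e : Fin r →₀ ℕ) (c : ℂ) :
    diagFunctional g (monomial e c) = c * ∏ j, g j (e j) := by
  have h : (monomial e c : MvPolynomial (Fin r) ℂ) = c • basisMonomials (Fin r) ℂ e := by
    simp [smul_monomial]
  rw [h, map_smul, diagFunctional, Module.Basis.constr_basis, smul_eq_mul]

/-- Makes coefficient extraction an instance of `diagFunctional`, so one evaluation of shifted
alternants serves both `gbinom_eq_det` and `sum_gbinom_mul_gbinom`. -/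
theorem diagFunctional_indicator {r : ℕ} (l : Fin r → ℕ) (p : MvPolynomial (Fin r) ℂ) :
    diagFunctional (fun j i => if i = l j then 1 else 0) p =
      coeff (Finsupp.equivFunOnFinite.symm l) p := by
  induction p using MvPolynomial.induction_on' with
  | monomial e c =>
    rw [diagFunctional_monomial, coeff_monomial, Fintype.prod_ite_zero]
    have h : (∀ j, e j = l j) ↔ e = Finsupp.equivFunOnFinite.symm l := by
      simp [Finsupp.ext_iff]
    simp [h]
  | add p q hp hq => rw [map_add, coeff_add, hp, hq]

theorem diagFunctional_prod_sum {r : ℕ} (g : Fin r → ℕ → ℂ) (s : Fin r → Finset ℕ)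
    (c : Fin r → ℕ → ℂ) :
    diagFunctional g (∏ j, ∑ i ∈ s j, monomial (Finsupp.single j i) (c j i)) =
      ∏ j, ∑ i ∈ s j, c j i * g j i := by
  classical
  rw [prod_univ_sum, prod_univ_sum, map_sum]
  refine sum_congr rfl fun f _ => ?_
  have h : ∏ j, (monomial (Finsupp.single j (f j)) (c j (f j)) : MvPolynomial (Fin r) ℂ) =
      monomial (Finsupp.equivFunOnFinite.symm f) (∏ j, c j (f j)) := by
    rw [← monomial_sum_prod]
    congr 2
    ext j
    simp [Finsupp.finsetSum_apply, Finsupp.single_apply]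
  rw [h, diagFunctional_monomial, prod_mul_distrib]
  rfl

theorem diagFunctional_alternant {r : ℕ} (g : Fin r → ℕ → ℂ) (a : Fin r → ℕ) :
    diagFunctional g (alternant a) = Matrix.det (Matrix.of fun k j => g j (a k)) := by
  rw [alternant_eq_sum, map_sum, ← Matrix.det_transpose, Matrix.det_apply']
  refine sum_congr rfl fun σ _ => ?_
  rw [diagFunctional_monomial,
    ← Equiv.prod_comp σ (fun j => g j (Finsupp.equivFunOnFinite.symm (a ∘ σ.symm) j))]
  simp

theorem one_add_X_pow {r : ℕ} (j : Fin r) (n : ℕ) :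
    (1 + X j : MvPolynomial (Fin r) ℂ) ^ n =
      ∑ i ∈ range (n + 1), monomial (Finsupp.single j i) (n.choose i : ℂ) := by
  rw [add_comm, add_pow]
  refine sum_congr rfl fun i _ => ?_
  rw [one_pow, mul_one, ← C_mul_X_pow_eq_monomial, mul_comm]
  simp

/-- The functional is not multiplicative in general, but each Leibniz term is a product of
polynomials in distinct variables, and on such products it is; the binomial theorem then evaluates
each factor. -/
theorem diagFunctional_shiftOne_alternant {r : ℕ} (g : Fin r → ℕ → ℂ) (a : Fin r → ℕ) :
    diagFunctional g (shiftOne (alternant a)) = Matrix.det (Matrix.of fun k j =>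
      ∑ i ∈ range (a k + 1), ((a k).choose i : ℂ) * g j i) := by
  have h : shiftOne (alternant a) = ∑ σ : Equiv.Perm (Fin r), ((Equiv.Perm.sign σ : ℤ) : ℂ) •
      ∏ j, ∑ i ∈ range (a (σ j) + 1),
        (monomial (Finsupp.single j i) ((a (σ j)).choose i : ℂ) : MvPolynomial (Fin r) ℂ) := by
    rw [alternant, AlgHom.map_det, ← Matrix.det_transpose, Matrix.det_apply']
    refine sum_congr rfl fun σ _ => ?_
    simp only [← one_add_X_pow, smul_eq_C_mul]
    simp [shiftOne]
  rw [h, map_sum, Matrix.det_apply']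
  refine sum_congr rfl fun σ _ => ?_
  rw [map_smul, diagFunctional_prod_sum, smul_eq_mul]
  rfl

/-! ### Generalized binomial coefficients as determinants. -/

theorem shiftOne_alternant_eq_sum_gbinom {r : ℕ} (m : Part r) :
    ∃ h : (Function.support (gbinom m)).Finite, shiftOne (alternant (m.1 + delta r)) =
      ∑ k ∈ h.toFinset, (schurOne m * gbinom m k / schurOne k) • alternant (k.1 + delta r) := by
  obtain ⟨h, hs⟩ := gbinom_spec m
  refine ⟨h, ?_⟩
  have h1 : alternant (m.1 + delta r) =
      schurOne m • (alternant (delta r) * spherical m) := by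
    rw [alternant_delta_mul_spherical, smul_smul, mul_inv_cancel₀ (schurOne_ne_zero m), one_smul]
  rw [h1, map_smul, map_mul, shiftOne_alternant_delta, hs, mul_sum, smul_sum]
  refine sum_congr rfl fun k _ => ?_
  rw [mul_smul_comm, alternant_delta_mul_spherical, smul_smul, smul_smul, div_eq_mul_inv]

/-- Among the alternants of l + δ, only l = k contains the monomial with exponent k + δ, so that
coefficient isolates one term of the expansion. -/
theorem gbinom_eq_det {r : ℕ} (m k : Part r) :
    gbinom m k = schurOne k / schurOne m * Matrix.det (Matrix.of fun i j =>
      (((m.1 + delta r) i).choose ((k.1 + delta r) j) : ℂ)) := by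
  classical
  obtain ⟨h, hs⟩ := shiftOne_alternant_eq_sum_gbinom m
  have h1 := congrArg (coeff (Finsupp.equivFunOnFinite.symm (k.1 + delta r))) hs
  rw [← diagFunctional_indicator, diagFunctional_shiftOne_alternant, coeff_sum] at h1
  simp only [coeff_smul, coeff_alternant, smul_eq_mul, mul_ite, mul_one, mul_zero, sum_ite_eq,
    Set.Finite.mem_toFinset, Function.mem_support, sum_ite_eq'] at h1
  -- The cutoff coming from the finite binomial sum is harmless: beyond it the binomial coefficient
  -- vanishes.
  have h2 : (Matrix.of fun i j => (((m.1 + delta r) i).choose ((k.1 + delta r) j) : ℂ)) =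
      Matrix.of fun i j => if (k.1 + delta r) j ∈ range ((m.1 + delta r) i + 1) then
        (((m.1 + delta r) i).choose ((k.1 + delta r) j) : ℂ) else 0 := by
    ext i j
    simp only [Matrix.of_apply, mem_range]
    split_ifs with hlt
    · rfl
    · rw [Nat.choose_eq_zero_of_lt (by omega), Nat.cast_zero]
  rw [h2, h1]
  have hk := schurOne_ne_zero k
  have hm := schurOne_ne_zero m
  split_ifs with h0
  · field_simp
  · rw [mul_zero]; exact not_not.1 h0

/-- If m_t < k_t, every Leibniz term vanishes. By pigeonhole some j ≤ t has σ j ≥ t, and then m + δ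
at σ j is at most its value at t, which is less than k + δ at t, hence less than k + δ at j. -/
theorem gbinom_eq_zero {r : ℕ} {m k : Part r} (h : k ∉ subparts m) : gbinom m k = 0 := by
  rw [mem_subparts, not_forall] at h
  obtain ⟨t, ht⟩ := h
  rw [gbinom_eq_det, Matrix.det_apply, sum_eq_zero, mul_zero]
  intro σ _
  obtain ⟨j, hjt, hj⟩ : ∃ j ≤ t, t ≤ σ j := by
    by_contra! hcon
    have h1 := card_le_card_of_injOn σ (s := Iic t) (t := Iio t)
      (fun j hj => by simpa using hcon j (by simpa using hj)) σ.injective.injOn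
    simp at h1
  have h1 := (strictAnti_add_delta m).antitone hj
  have h2 := (strictAnti_add_delta k).antitone hjt
  have h3 : (m.1 + delta r) t < (k.1 + delta r) t := by simp only [Pi.add_apply]; omega
  rw [prod_eq_zero (mem_univ j), smul_zero]
  rw [Matrix.of_apply, Nat.choose_eq_zero_of_lt (by omega), Nat.cast_zero]

theorem shiftOne_alternant_eq_sum_subparts {r : ℕ} (m : Part r) :
    shiftOne (alternant (m.1 + delta r)) = ∑ k ∈ subparts m,
      (schurOne m * gbinom m k / schurOne k) • alternant (k.1 + delta r) := by
  obtain ⟨h, hs⟩ := shiftOne_alternant_eq_sum_gbinom m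
  rw [hs]
  refine sum_subset (fun k hk => ?_) fun k _ hk => ?_
  · by_contra hk'
    simp [gbinom_eq_zero hk'] at hk
  · have : gbinom m k = 0 := by simpa using hk
    simp [this]

/-! ### The weighted Cauchy–Binet identity. -/

/-- A weighted form of the Cauchy–Binet formula for the generalized binomial coefficients. -/
theorem sum_gbinom_mul_gbinom {r : ℕ} (m x : Part r) (w : ℕ → ℂ) :
    ∑ k ∈ subparts m, (∏ j, w ((k.1 + delta r) j)) / dimPart k * gbinom m k * gbinom x k =
      1 / (schurOne m * schurOne x) * Matrix.det (Matrix.of fun i j =>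
        ∑ l ∈ range ((m.1 + delta r) i + 1),
          w l * ((m.1 + delta r) i).choose l * ((x.1 + delta r) j).choose l) := by
  have h := congrArg (diagFunctional fun j l => w l * (((x.1 + delta r) j).choose l : ℂ))
    (shiftOne_alternant_eq_sum_subparts m)
  rw [diagFunctional_shiftOne_alternant, map_sum] at h
  have e : (Matrix.of fun i j => ∑ l ∈ range ((m.1 + delta r) i + 1),
        w l * ((m.1 + delta r) i).choose l * (((x.1 + delta r) j).choose l : ℂ)) =
      Matrix.of fun i j => ∑ l ∈ range ((m.1 + delta r) i + 1),
        (((m.1 + delta r) i).choose l : ℂ) * (w l * ((x.1 + delta r) j).choose l) := by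
    ext i j
    simp only [Matrix.of_apply]
    exact sum_congr rfl fun l _ => by ring
  rw [e, h, mul_sum]
  refine sum_congr rfl fun k _ => ?_
  -- The weight depends only on the row and factors out; what is left is the transpose of the matrix
  -- in `gbinom_eq_det` for x and k.
  have hd : Matrix.det (Matrix.of fun i j : Fin r =>
      w ((k.1 + delta r) i) * (((x.1 + delta r) j).choose ((k.1 + delta r) i) : ℂ)) =
        (∏ j, w ((k.1 + delta r) j)) * (schurOne x / schurOne k * gbinom x k) := by
    rw [gbinom_eq_det, ← Matrix.det_transpose (Matrix.of fun i j =>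
      (((x.1 + delta r) i).choose ((k.1 + delta r) j) : ℂ)), ← mul_assoc (schurOne x / _),
      div_mul_div_cancel₀ (schurOne_ne_zero k), div_self (schurOne_ne_zero x), one_mul,
      ← Matrix.det_mul_column]
    rfl
  rw [map_smul, diagFunctional_alternant, hd, dimPart_eq, smul_eq_mul]
  have hk := schurOne_ne_zero k
  have hm := schurOne_ne_zero m
  have hx := schurOne_ne_zero x
  field_simp

/-! ### Products of the weights over k + δ. -/

theorem poch_add (a : ℂ) (m n : ℕ) : poch a (m + n) = poch a m * poch (a + m) n := by
  simp only [poch, ← ascPochhammer_mul, Polynomial.eval_mul, Polynomial.eval_comp,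
    Polynomial.eval_add, Polynomial.eval_X, Polynomial.eval_natCast]

theorem factorial_add_eq_mul_poch (m n : ℕ) :
    ((m + n).factorial : ℂ) = m.factorial * poch (m + 1) n := by
  have h : poch (m + 1) n = (((m + 1).ascFactorial n : ℕ) : ℂ) := by
    rw [poch, ← ascPochhammer_nat_eq_natCast_ascFactorial]
    push_cast; rfl
  rw [h, ← Nat.factorial_mul_ascFactorial]
  push_cast; rfl

theorem cast_delta {r : ℕ} (j : Fin r) : (delta r j : ℂ) = r - 1 - (j : ℕ) := by
  have h : delta r j + 1 + (j : ℕ) = r := by simp only [delta]; omega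
  have h' : (delta r j : ℂ) + 1 + (j : ℕ) = r := by exact_mod_cast h
  linear_combination h'

/-- Since δ_j = r - 1 - j with j counted from 0, the factors after the first δ_j start at (a - r +
1) + δ_j = a - j, as in `genPoch`. This explains the parameter shift from α to α - r + 1. -/
theorem prod_poch_add_delta {r : ℕ} (a : ℂ) (k : Part r) :
    ∏ j, poch (a - r + 1) ((k.1 + delta r) j) =
      (∏ j, poch (a - r + 1) (delta r j)) * genPoch a k := by
  rw [genPoch, ← prod_mul_distrib]
  refine prod_congr rfl fun j _ => ?_
  rw [Pi.add_apply, add_comm (k.1 j), poch_add, cast_delta]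
  congr 2
  ring

theorem prod_factorial_add_delta {r : ℕ} (k : Part r) :
    ∏ j, (((k.1 + delta r) j).factorial : ℂ) =
      (multiFactorial (delta r) : ℂ) * genPoch r k := by
  rw [genPoch, multiFactorial, Nat.cast_prod, ← prod_mul_distrib]
  refine prod_congr rfl fun j _ => ?_
  rw [Pi.add_apply, add_comm, factorial_add_eq_mul_poch, cast_delta]
  congr 2
  ring

theorem multiFactorial_ne_zero {r : ℕ} (m : Fin r → ℕ) : (multiFactorial m : ℂ) ≠ 0 := by
  rw [multiFactorial, Nat.cast_ne_zero]
  exact prod_ne_zero_iff.2 fun j _ => Nat.factorial_ne_zero _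

theorem sum_delta (r : ℕ) : ∑ j, delta r j = r * (r - 1) / 2 := by
  rw [← Finset.sum_range_id]
  simp only [delta_eq_rev]
  rw [← Fin.sum_univ_eq_sum_range (fun i => i)]
  exact Equiv.sum_comp Fin.revPerm (fun j : Fin r => (j : ℕ))

theorem prod_pow_add_delta {r : ℕ} (z : ℂ) (k : Part r) :
    ∏ j, z ^ (k.1 + delta r) j = z ^ weight k * z ^ (r * (r - 1) / 2) := by
  rw [prod_pow_eq_pow_sum, ← pow_add, ← sum_delta, weight, ← sum_add_distrib]
  rfl

/-- Both index families run through 0, …, r - 1, in opposite orders. -/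
theorem prod_Icc_eq_prod_delta {r : ℕ} (f : ℕ → ℂ) :
    ∏ j ∈ Icc 1 r, f (j - 1) = ∏ j, f (delta r j) := by
  simp only [delta_eq_rev]
  have h : ∏ j : Fin r, f (Fin.rev j : ℕ) = ∏ j : Fin r, f j :=
    Equiv.prod_comp Fin.revPerm fun j : Fin r => f j
  rw [h, Fin.prod_univ_eq_prod_range,
    range_eq_Ico, prod_Ico_eq_prod_range, ← Ico_add_one_right_eq_Icc, prod_Ico_eq_prod_range]
  simp

/-! ### Determinant formulas for the three families. -/

/-- The determinant formula common to the Meixner and Krawtchouk families. -/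
theorem sum_genPoch_eq_det {r : ℕ} (m x : Part r) (α z : ℂ)
    (hα : ∀ j : Fin r, poch (α - r + 1) (delta r j) ≠ 0) (hz : 2 ≤ r → z ≠ 0) :
    ∑ k ∈ subparts m, 1 / dimPart k * (genPoch r k / genPoch α k) * gbinom m k * gbinom x k *
        z ^ weight k =
      1 / (multiFactorial (delta r) : ℂ) *
        ((z ^ (r * (r - 1) / 2))⁻¹ / (schurOne m * schurOne x)) *
        (∏ j ∈ Icc 1 r, poch (α - r + 1) (j - 1)) *
        Matrix.det (Matrix.of fun μ ν : Fin r => ∑ l ∈ range (m.1 μ + delta r μ + 1),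
          (l.factorial : ℂ) / poch (α - r + 1) l * ((m.1 μ + delta r μ).choose l : ℂ) *
            ((x.1 ν + delta r ν).choose l : ℂ) * z ^ l) := by
  have key := sum_gbinom_mul_gbinom m x
    (fun l => (l.factorial : ℂ) / poch (α - r + 1) l * z ^ l)
  -- Only these factors have to be cancelled. `genPoch α k` is a divisor on both sides, so the terms
  -- agree even where it is zero and division by it gives 0.
  have hP : (∏ j, poch (α - r + 1) (delta r j)) ≠ 0 := prod_ne_zero_iff.2 fun j _ => hα j
  have hF := multiFactorial_ne_zero (delta r)
  -- For r < 2 the exponent is 0, so z = 0 is allowed there.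
  have hZ : z ^ (r * (r - 1) / 2) ≠ 0 := by
    rcases lt_or_ge r 2 with h | h
    · interval_cases r <;> simp
    · exact pow_ne_zero _ (hz h)
  simp only [prod_mul_distrib, prod_div_distrib, prod_poch_add_delta, prod_factorial_add_delta,
    prod_pow_add_delta] at key
  have e : (Matrix.of fun μ ν : Fin r => ∑ l ∈ range (m.1 μ + delta r μ + 1),
          (l.factorial : ℂ) / poch (α - r + 1) l * ((m.1 μ + delta r μ).choose l : ℂ) *
            ((x.1 ν + delta r ν).choose l : ℂ) * z ^ l) =
      Matrix.of fun i j => ∑ l ∈ range ((m.1 + delta r) i + 1),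
        (l.factorial : ℂ) / poch (α - r + 1) l * z ^ l * ((m.1 + delta r) i).choose l *
          ((x.1 + delta r) j).choose l := by
    ext i j
    simp only [Matrix.of_apply, Pi.add_apply]
    exact sum_congr rfl fun l _ => by ring
  rw [e, prod_Icc_eq_prod_delta (fun n => poch (α - r + 1) n)]
  trans 1 / (multiFactorial (delta r) : ℂ) * (z ^ (r * (r - 1) / 2))⁻¹ *
    (∏ j, poch (α - r + 1) (delta r j)) * (1 / (schurOne m * schurOne x) *
      Matrix.det (Matrix.of fun i j => ∑ l ∈ range ((m.1 + delta r) i + 1),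
        (l.factorial : ℂ) / poch (α - r + 1) l * z ^ l * ((m.1 + delta r) i).choose l *
          (((x.1 + delta r) j).choose l : ℂ)))
  · rw [← key, mul_sum]
    refine sum_congr rfl fun k _ => ?_
    field_simp
  · ring

theorem poch_ne_zero {a : ℂ} {n : ℕ} (h : ∀ i < n, a ≠ -(i : ℂ)) : poch a n ≠ 0 := by
  rw [poch, Ne, ascPochhammer_eval_eq_zero_iff]
  rintro ⟨i, hi, hia⟩
  exact h i hi (by rw [hia, neg_neg])

theorem meixner_eq_det {r : ℕ} (m x : Part r) (α c : ℂ)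
    (hα : ∀ t : ℤ, t ≤ (r : ℤ) - 1 → α ≠ (t : ℂ)) (hc : c ≠ 0) (hc1 : 2 ≤ r → c ≠ 1) :
    meixner m x α c = 1 / (multiFactorial (delta r) : ℂ) *
      ((1 - 1 / c) ^ (-((r * (r - 1) / 2 : ℕ) : ℤ)) / (schurOne m * schurOne x)) *
      (∏ j ∈ Icc 1 r, poch (α - r + 1) (j - 1)) *
      Matrix.det (Matrix.of fun μ ν : Fin r =>
        meixner₁ (m.1 μ + delta r μ) (x.1 ν + delta r ν) (α - r + 1) c) := by
  rw [zpow_neg, zpow_natCast]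
  refine sum_genPoch_eq_det m x α (1 - 1 / c) (fun j => poch_ne_zero fun i _ h => ?_)
    fun hr h => hc1 hr ?_
  -- A vanishing factor α - r + 1 + i would make α this excluded integer.
  · refine hα ((r : ℤ) - 1 - i) (by omega) ?_
    push_cast
    linear_combination h
  · field_simp at h
    linear_combination h

theorem krawtchouk_eq_det {r : ℕ} (m x : Part r) (p : ℂ) (N : ℕ) (hp : p ≠ 0) :
    krawtchouk m x p N = 1 / (multiFactorial (delta r) : ℂ) *
      (p ^ (r * (r - 1) / 2) / (schurOne m * schurOne x)) *
      (∏ j ∈ Icc 1 r, poch (-(N : ℂ) - r + 1) (j - 1)) *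
      Matrix.det (Matrix.of fun μ ν : Fin r =>
        krawtchouk₁ (m.1 μ + delta r μ) (x.1 ν + delta r ν) p (N + r - 1)) := by
  have e : (Matrix.of fun μ ν : Fin r =>
        krawtchouk₁ (m.1 μ + delta r μ) (x.1 ν + delta r ν) p (N + r - 1)) =
      Matrix.of fun μ ν : Fin r => ∑ l ∈ range (m.1 μ + delta r μ + 1),
          (l.factorial : ℂ) / poch (-(N : ℂ) - r + 1) l * ((m.1 μ + delta r μ).choose l : ℂ) *
            ((x.1 ν + delta r ν).choose l : ℂ) * (1 / p) ^ l := by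
    ext μ ν
    -- The index μ forces r ≥ 1, so the natural subtraction does not truncate; for r = 0 the matrix
    -- is empty.
    have hN : -((N + r - 1 : ℕ) : ℂ) = -(N : ℂ) - r + 1 := by
      have := μ.2
      rw [Nat.cast_sub (by omega)]
      push_cast; ring
    simp only [Matrix.of_apply, krawtchouk₁, hN]
  have hpow : p ^ (r * (r - 1) / 2) = ((1 / p) ^ (r * (r - 1) / 2))⁻¹ := by
    rw [one_div, inv_pow, inv_inv]
  rw [e, hpow]
  refine sum_genPoch_eq_det m x (-(N : ℂ)) (1 / p) (fun j => poch_ne_zero fun i hi h => ?_)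
    fun _ => one_div_ne_zero hp
  -- A zero factor would need i + 1 = N + r, whereas i < δ_j ≤ r - 1.
  have h1 : ((i + 1 : ℕ) : ℂ) = ((N + r : ℕ) : ℂ) := by push_cast; linear_combination h
  have h2 := Nat.cast_injective h1
  have h3 := j.2
  simp only [delta] at hi
  omega

/-- The weight l! (-1/a)^l has no Pochhammer denominator, so this is not an instance of
`sum_genPoch_eq_det`; the same splitting over k + δ applies. -/
theorem charlier_eq_det {r : ℕ} (m x : Part r) (a : ℂ) (ha : a ≠ 0) :
    charlier m x a = 1 / (multiFactorial (delta r) : ℂ) *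
      ((-a) ^ (r * (r - 1) / 2) / (schurOne m * schurOne x)) *
      Matrix.det (Matrix.of fun μ ν : Fin r =>
        charlier₁ (m.1 μ + delta r μ) (x.1 ν + delta r ν) a) := by
  have key := sum_gbinom_mul_gbinom m x (fun l => (l.factorial : ℂ) * (-1 / a) ^ l)
  have hF := multiFactorial_ne_zero (delta r)
  have hZ : (-1 / a) ^ (r * (r - 1) / 2) ≠ 0 := pow_ne_zero _ (by simpa using ha)
  have hpow : (-a) ^ (r * (r - 1) / 2) = ((-1 / a) ^ (r * (r - 1) / 2))⁻¹ := by
    rw [← inv_pow, inv_div, div_neg, div_one]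
  simp only [prod_mul_distrib, prod_factorial_add_delta, prod_pow_add_delta] at key
  have e : (Matrix.of fun μ ν : Fin r =>
        charlier₁ (m.1 μ + delta r μ) (x.1 ν + delta r ν) a) =
      Matrix.of fun i j => ∑ l ∈ range ((m.1 + delta r) i + 1),
        (l.factorial : ℂ) * (-1 / a) ^ l * ((m.1 + delta r) i).choose l *
          ((x.1 + delta r) j).choose l := by
    ext i j
    simp only [Matrix.of_apply, Pi.add_apply, charlier₁]
    exact sum_congr rfl fun l _ => by ring
  rw [e, hpow]
  trans 1 / (multiFactorial (delta r) : ℂ) * ((-1 / a) ^ (r * (r - 1) / 2))⁻¹ *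
    (1 / (schurOne m * schurOne x) *
      Matrix.det (Matrix.of fun i j => ∑ l ∈ range ((m.1 + delta r) i + 1),
        (l.factorial : ℂ) * (-1 / a) ^ l * ((m.1 + delta r) i).choose l *
          (((x.1 + delta r) j).choose l : ℂ)))
  · rw [← key, mul_sum, charlier]
    refine sum_congr rfl fun k _ => ?_
    -- With -1/a as an atom, `hZ` cancels its power directly.
    generalize -1 / a = z at *
    field_simp
  · ring

end MultiDOP

theorem mainTheorem7 (r : ℕ) :
    (∀ (m x : MultiDOP.Part r) (α c : ℂ),
      (∀ t : ℤ, t ≤ (r : ℤ) - 1 → α ≠ (t : ℂ)) → c ≠ 0 → (2 ≤ r → c ≠ 1) →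
      MultiDOP.meixner m x α c =
        1 / (MultiDOP.multiFactorial (MultiDOP.delta r) : ℂ) *
          ((1 - 1 / c) ^ (-((r * (r - 1) / 2 : ℕ) : ℤ)) /
            (MultiDOP.schurOne m * MultiDOP.schurOne x)) *
          (∏ j ∈ Finset.Icc 1 r, MultiDOP.poch (α - r + 1) (j - 1)) *
          Matrix.det (Matrix.of fun μ ν : Fin r =>
            MultiDOP.meixner₁ (m.1 μ + MultiDOP.delta r μ) (x.1 ν + MultiDOP.delta r ν)
              (α - r + 1) c)) ∧
    (∀ (m x : MultiDOP.Part r) (a : ℂ), a ≠ 0 →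
      MultiDOP.charlier m x a =
        1 / (MultiDOP.multiFactorial (MultiDOP.delta r) : ℂ) *
          ((-a) ^ (r * (r - 1) / 2) / (MultiDOP.schurOne m * MultiDOP.schurOne x)) *
          Matrix.det (Matrix.of fun μ ν : Fin r =>
            MultiDOP.charlier₁ (m.1 μ + MultiDOP.delta r μ) (x.1 ν + MultiDOP.delta r ν) a)) ∧
    (∀ (m x : MultiDOP.Part r) (p : ℂ) (N : ℕ), p ≠ 0 →
      (∀ j, m.1 j ≤ N) → (∀ j, x.1 j ≤ N) →
      MultiDOP.krawtchouk m x p N =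
        1 / (MultiDOP.multiFactorial (MultiDOP.delta r) : ℂ) *
          (p ^ (r * (r - 1) / 2) / (MultiDOP.schurOne m * MultiDOP.schurOne x)) *
          (∏ j ∈ Finset.Icc 1 r, MultiDOP.poch (-(N : ℂ) - r + 1) (j - 1)) *
          Matrix.det (Matrix.of fun μ ν : Fin r =>
            MultiDOP.krawtchouk₁ (m.1 μ + MultiDOP.delta r μ) (x.1 ν + MultiDOP.delta r ν)
              p (N + r - 1))) :=
  ⟨fun m x α c hα hc hc1 => MultiDOP.meixner_eq_det m x α c hα hc hc1,
    fun m x a ha => MultiDOP.charlier_eq_det m x a ha,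
    fun m x p N hp _ _ => MultiDOP.krawtchouk_eq_det m x p N hp⟩
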